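/- \textbf{Model.} There are $N$ items and $K\ge 1$ classes of consumers. Class $k$ has arrival rate $\lambda_k>0$ and weight $w_k=\lambda_k/\sum_l\lambda_l$. Item $i$ has appeal $a_{i,k}>0$ and quality $q_{i,k}\in[0,1]$ for class $k$; the positions have visibilities $v_1\ge\dots\ge v_N\ge 0$, not all zero; $z\ge 0$. Consumers $t=0,1,2,\dots$ arrive one at a time, each belonging to class $k$ with probability $w_k$ independently of the past. A consumer of class $k$ who is shown a ranking $\sigma\in S_N$ (item $i$ in position $\sigma(i)$) and a popularity vector $d\in\mathbb N^N$ tries item $i$ with probability $\frac{v_{\sigma(i)}(a_{i,k}+d_i)}{\sum_j v_{\sigma(j)}(a_{j,k}+d_j)+z}$ (and no item with the remaining probability), and then buys the tried item with probability $q_{i,k}$. There are no purchases before time $0$. Put $\bar q_i=\sum_k w_kq_{i,k}$. An \emph{average quality ranking} is a $\sigma\in S_N$ that lists the items in decreasing order of $\bar q_i$; it is \emph{tie-breaking} if some item $i^*$ satisfies $\bar q_{i^*}v_{\sigma(i^*)}>\bar q_iv_{\sigma(i)}$ for all $i\ne i^*$. A \emph{segmented quality ranking} consists of permutations $\tau_k$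 ($k\in[K]$), where $\tau_k$ lists the items in decreasing order of $q_{i,k}$; it is \emph{tie-breaking} if for each $k$ some item $i_k^*$ satisfies $q_{i_k^*,k}>q_{j,k}$ for all $j\ne i_k^*$. Ties in the orders may be resolved arbitrarily. Let $P^t_{AQGSI}$ be the probability that consumer $t$ makes a purchase when every consumer is shown an average quality ranking $\sigma$ and the vector of all past purchases, and $P^t_{SQSSI}$ the probability that consumer $t$ makes a purchase when every consumer of class $k$ is shown $\tau_k$ and the vector of past purchases by class $k$ only. \textbf{Proposition.} The upper bound $K$ in the bound $1\le\lim_{t\to\infty}P^t_{SQSSI}/P^t_{AQGSI}\le K$ for models whose average and segmented quality rankings are tie-breaking is tight. Precisely, let $K\ge1$. (1) Let $N=K$, let $\lambda_k>0$ be any rates, and number the classes so that $w_1=\min_jw_j$. Let $a_{i,k}>0$ be any appeals, $v_1\ge\dots\ge v_K\ge0$ any visibilities that are not all zero, and $z\ge 0$. For $\varepsilon>0$ with $\varepsilon<\min_jw_j/w_k$ for all $k\neq 1$, let $$q_{i,k}=\begin{cases}\dfrac{\min_jw_j}{w_1}&\text{if }i=k=1,\\[2mm] \dfrac{\min_jw_j}{w_k}-\varepsilon&\text{if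 }i=k\ne1,\\[1mm] 0&\text{otherwise.}\end{cases}$$ This defines a valid model. Every average quality ranking and every segmented quality ranking of it is tie-breaking. The limits $P_{SQSSI}(\varepsilon)=\lim_{t\to\infty}P^t_{SQSSI}$ and $P_{AQGSI}(\varepsilon)=\lim_{t\to\infty}P^t_{AQGSI}$ exist and do not depend on the choice of these rankings, $P_{AQGSI}(\varepsilon)>0$, and $\lim_{t\to\infty}P^t_{SQSSI}/P^t_{AQGSI}=P_{SQSSI}(\varepsilon)/P_{AQGSI}(\varepsilon)$. Moreover $$\lim_{\varepsilon\to0^+}\frac{P_{SQSSI}(\varepsilon)}{P_{AQGSI}(\varepsilon)}=K .$$ (2) Consequently, for every real $C<K$ there is a model with $K$ items and $K$ classes, with tie-breaking average and segmented quality rankings, such that $L=\lim_{t\to\infty}P^t_{SQSSI}/P^t_{AQGSI}$ exists and $C<L\le K$. -/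

import Mathlib

open Filter Topology

noncomputable section

/-- The weight of class `k`: its share of the total arrival rate. -/
def classWeight {K : ℕ} (rate : Fin K → ℝ) (k : Fin K) : ℝ :=
  rate k / ∑ l, rate l

/-- A mixed multinomial logit (MMNL) trial-offer market with `N` items and `K` classes of
consumers. Positions are indexed by decreasing visibility. -/
structure MMNL (N K : ℕ) where
  /-- arrival rates of the classes -/
  rate : Fin K → ℝ
  /-- `appeal i k`: appeal of item `i` for class `k` -/
  appeal : Fin N → Fin K → ℝ
  /-- `quality i k`: probability that a consumer of class `k` who tries item `i` buys it -/
  quality : Fin N → Fin K → ℝ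
  /-- `vis j`: visibility of position `j` -/
  vis : Fin N → ℝ
  /-- the no-trial constant -/
  z : ℝ
  classes_pos : 0 < K
  rate_pos : ∀ k, 0 < rate k
  appeal_pos : ∀ i k, 0 < appeal i k
  quality_nonneg : ∀ i k, 0 ≤ quality i k
  quality_le_one : ∀ i k, quality i k ≤ 1
  vis_nonneg : ∀ j, 0 ≤ vis j
  vis_antitone : Antitone vis
  exists_vis_pos : ∃ j, 0 < vis j
  z_nonneg : 0 ≤ z

namespace MMNL

variable {N K : ℕ} (M : MMNL N K)

/-- The weight `w k` of class `k`. -/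
def weight (k : Fin K) : ℝ := classWeight M.rate k

/-- The weighted average quality of item `i`. -/
def avgQuality (i : Fin N) : ℝ := ∑ k, M.weight k * M.quality i k

/-- The probability that a consumer of class `k` tries item `i`, when item `j` is displayed in
position `σ j` and the popularity vector `d` is shown. -/
def tryProb (σ : Equiv.Perm (Fin N)) (d : Fin N → ℕ) (k : Fin K) (i : Fin N) : ℝ :=
  M.vis (σ i) * (M.appeal i k + d i) / (∑ j, M.vis (σ j) * (M.appeal j k + d j) + M.z)

theorem weight_nonneg (k : Fin K) : 0 ≤ M.weight k :=
  div_nonneg (M.rate_pos k).le (Finset.sum_nonneg fun l _ => (M.rate_pos l).le)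

theorem sum_weight : ∑ k, M.weight k = 1 := by
  have : Nonempty (Fin K) := ⟨⟨0, M.classes_pos⟩⟩
  have h : 0 < ∑ l, M.rate l :=
    Finset.sum_pos (fun l _ => M.rate_pos l) Finset.univ_nonempty
  simp only [weight, classWeight]
  rw [← Finset.sum_div, div_self h.ne']

theorem vis_mul_nonneg (σ : Equiv.Perm (Fin N)) (d : Fin N → ℕ) (k : Fin K) (i : Fin N) :
    0 ≤ M.vis (σ i) * (M.appeal i k + d i) :=
  mul_nonneg (M.vis_nonneg _) (add_nonneg (M.appeal_pos i k).le (Nat.cast_nonneg _))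

theorem tryProb_nonneg (σ : Equiv.Perm (Fin N)) (d : Fin N → ℕ) (k : Fin K) (i : Fin N) :
    0 ≤ M.tryProb σ d k i :=
  div_nonneg (M.vis_mul_nonneg σ d k i)
    (add_nonneg (Finset.sum_nonneg fun j _ => M.vis_mul_nonneg σ d k j) M.z_nonneg)

theorem sum_tryProb_le_one (σ : Equiv.Perm (Fin N)) (d : Fin N → ℕ) (k : Fin K) :
    ∑ i, M.tryProb σ d k i ≤ 1 := by
  simp only [tryProb]
  rw [← Finset.sum_div]
  exact div_le_one_of_le₀ (le_add_of_nonneg_right M.z_nonneg)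
    (add_nonneg (Finset.sum_nonneg fun j _ => M.vis_mul_nonneg σ d k j) M.z_nonneg)

/-- The law of the class of the next consumer. -/
def arrivalLaw : PMF (Fin K) :=
  PMF.ofFintype (fun k => ENNReal.ofReal (M.weight k)) (by
    rw [← ENNReal.ofReal_sum_of_nonneg fun k _ => M.weight_nonneg k, M.sum_weight,
      ENNReal.ofReal_one])

/-- The law of the item tried by a consumer of class `k` (`none`: no item is tried). -/
def tryLaw (σ : Equiv.Perm (Fin N)) (d : Fin N → ℕ) (k : Fin K) : PMF (Option (Fin N)) :=
  PMF.ofFintype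
    (fun o => o.elim (ENNReal.ofReal (1 - ∑ i, M.tryProb σ d k i))
      (fun i => ENNReal.ofReal (M.tryProb σ d k i))) (by
    rw [Fintype.sum_option]
    simp only [Option.elim_none, Option.elim_some]
    rw [← ENNReal.ofReal_sum_of_nonneg fun i _ => M.tryProb_nonneg σ d k i,
      ← ENNReal.ofReal_add (sub_nonneg.2 (M.sum_tryProb_le_one σ d k))
        (Finset.sum_nonneg fun i _ => M.tryProb_nonneg σ d k i),
      sub_add_cancel, ENNReal.ofReal_one])

/-- The law of the decision of a consumer of class `k` who has tried item `i`: `true` (purchase)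
with probability `quality i k`. -/
def buyLaw (k : Fin K) (i : Fin N) : PMF Bool :=
  PMF.ofFintype
    (fun b => cond b (ENNReal.ofReal (M.quality i k)) (ENNReal.ofReal (1 - M.quality i k))) (by
    rw [Fintype.sum_bool, cond_true, cond_false,
      ← ENNReal.ofReal_add (M.quality_nonneg i k) (sub_nonneg.2 (M.quality_le_one i k)),
      add_sub_cancel, ENNReal.ofReal_one])

/-- The law of the item purchased by a consumer of class `k` (`none`: no purchase). -/
def purchaseLaw (σ : Equiv.Perm (Fin N)) (d : Fin N → ℕ) (k : Fin K) : PMF (Option (Fin N)) :=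
  (M.tryLaw σ d k).bind fun o => o.elim (PMF.pure none) fun i =>
    (M.buyLaw k i).map fun b => if b then some i else none

/-- The law of the pair (class, purchased item) of the next consumer. Here `D k i` is the number of
past purchases of item `i` by class `k`; a consumer of class `k` sees the ranking `τ k` and the
popularity vector `signal D k`. -/
def consumerLaw (τ : Fin K → Equiv.Perm (Fin N))
    (signal : (Fin K → Fin N → ℕ) → Fin K → Fin N → ℕ) (D : Fin K → Fin N → ℕ) :
    PMF (Fin K × Option (Fin N)) :=
  M.arrivalLaw.bind fun k => (M.purchaseLaw (τ k) (signal D k) k).map fun o => (k, o)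

end MMNL

/-- The purchase counts after a consumer of class `c.1` has purchased `c.2`. -/
def recordPurchase {N K : ℕ} (D : Fin K → Fin N → ℕ) (c : Fin K × Option (Fin N)) :
    Fin K → Fin N → ℕ :=
  fun k i => D k i + if k = c.1 ∧ c.2 = some i then 1 else 0

/-- The global popularity signal: every consumer sees the purchases made by all classes. -/
def globalSignal {N K : ℕ} (D : Fin K → Fin N → ℕ) (_k : Fin K) : Fin N → ℕ :=
  fun i => ∑ l, D l i

/-- The segmented popularity signal: every consumer sees the purchases made by her own class. -/
def classSignal {N K : ℕ} (D : Fin K → Fin N → ℕ) (k : Fin K) : Fin N → ℕ := D k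

namespace MMNL

variable {N K : ℕ} (M : MMNL N K)

/-- The law of the purchase counts seen when consumer `t` arrives (`t = 0, 1, 2, …`): a Markov
chain started without purchases. -/
def countsLaw (τ : Fin K → Equiv.Perm (Fin N))
    (signal : (Fin K → Fin N → ℕ) → Fin K → Fin N → ℕ) : ℕ → PMF (Fin K → Fin N → ℕ)
  | 0 => PMF.pure 0
  | t + 1 => (countsLaw τ signal t).bind fun D =>
      (M.consumerLaw τ signal D).map (recordPurchase D)

/-- The probability that consumer `t` makes a purchase. -/
def purchaseProb (τ : Fin K → Equiv.Perm (Fin N))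
    (signal : (Fin K → Fin N → ℕ) → Fin K → Fin N → ℕ) (t : ℕ) : ℝ :=
  ((((M.countsLaw τ signal t).bind (M.consumerLaw τ signal)).map
    fun c => c.2.isSome) true).toReal

/-- Purchase probability at time `t` with one ranking `σ` for all consumers and the global
popularity signal. -/
def probAQGSI (σ : Equiv.Perm (Fin N)) (t : ℕ) : ℝ :=
  M.purchaseProb (fun _ => σ) globalSignal t

/-- Purchase probability at time `t` with one ranking `τ k` for each class `k` and the segmented
popularity signal. -/
def probSQSSI (τ : Fin K → Equiv.Perm (Fin N)) (t : ℕ) : ℝ :=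
  M.purchaseProb τ classSignal t

/-- `σ` is an average quality ranking (`σ i` is the position of item `i`): it lists the items by
decreasing weighted average quality. -/
def IsAvgQualityRanking (σ : Equiv.Perm (Fin N)) : Prop :=
  ∀ i j, M.avgQuality j < M.avgQuality i → σ i < σ j

/-- `τ` is a segmented quality ranking: `τ k` lists the items by decreasing quality for class
`k`. -/
def IsSegQualityRanking (τ : Fin K → Equiv.Perm (Fin N)) : Prop :=
  ∀ k i j, M.quality j k < M.quality i k → τ k i < τ k j

/-- The static ranking `σ` is tie-breaking. -/
def TieBreaking (σ : Equiv.Perm (Fin N)) : Prop :=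
  ∃ i₀, ∀ i, i ≠ i₀ → M.avgQuality i * M.vis (σ i) < M.avgQuality i₀ * M.vis (σ i₀)

/-- The segmented quality ranking is tie-breaking: each class has a unique best item. -/
def SegTieBreaking : Prop :=
  ∀ k, ∃ i₀, ∀ j, j ≠ i₀ → M.quality j k < M.quality i₀ k

end MMNL

/-- The diagonal qualities of the extremal model: `K` items, `K` classes of weights `w`, and a
distinguished class `k₀`. -/
def diagQuality {K : ℕ} (w : Fin K → ℝ) (k₀ : Fin K) (ε : ℝ) (i k : Fin K) : ℝ :=
  if i = k then (if k = k₀ then (⨅ j, w j) / w k₀ else (⨅ j, w j) / w k - ε) else 0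

end

/-! ### Pure jump chains on count vectors -/

/-! Class `k` can buy only item `k`, so the state of the market is the vector `n` of these purchase
counts, and each arrival raises one coordinate by one or changes nothing. The probability that
consumer `t` buys is the `t`-th power of the transition operator applied to the total jump rate,
evaluated at `0` (`purchaseProb_eq_jumpOp_pow`).

With segmented signals, item `k` is the only item whose popularity grows in the eyes of class `k`;
its share of trials tends to one and the limit is the sum of `w k * q k k`. With the global signal,
the chain is a linearly reinforced urn in which coordinate `i` has strength `w i * q i i * v (σ i)`.
Item `k₀` has the largest average quality, strictly because of `ε`, and the top position; it
therefore takes over the market, and only class `k₀` keeps buying, with limit `w k₀ * q k₀ k₀`.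
Writing `m` for the least weight, these limits are `K * m - (1 - m) * ε` and `m`, whose ratio tends
to `K`.

Both limits are proved in mean, without almost sure convergence. A nonnegative `V` with relative
drift at most `-δ / (∑ n + B)` has mean tending to zero: the total count grows by at most one per
step, so the decay factors are controlled by a divergent harmonic sum
(`IsJumpRate.tendsto_jumpOp_pow_of_drift`). It is applied to the inverse of a count and to the ratio
of a count to the dominant one. The ratio only drifts down once the dominant count is large;
`IsJumpRate.tendsto_jumpOp_pow_of_reached` removes this restriction. -/

section JumpChain

variable {ι : Type*} [Fintype ι] [DecidableEq ι]

/-- The transition operator of the Markov chain on count vectors that increments coordinate `i`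
with probability `r n i` and otherwise stays put. -/
noncomputable def jumpOp (r : (ι → ℕ) → ι → ℝ) : ((ι → ℕ) → ℝ) →ₗ[ℝ] ((ι → ℕ) → ℝ) where
  toFun f n := f n + ∑ i, r n i * (f (n + Pi.single i 1) - f n)
  map_add' f g := by
    ext n
    simp only [Pi.add_apply]
    rw [add_add_add_comm, ← Finset.sum_add_distrib]
    congr 1
    exact Finset.sum_congr rfl fun i _ => by ring
  map_smul' c f := by
    ext n
    simp only [Pi.smul_apply, smul_eq_mul, RingHom.id_apply, mul_add, Finset.mul_sum]
    congr 1
    exact Finset.sum_congr rfl fun i _ => by ring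

theorem jumpOp_apply (r : (ι → ℕ) → ι → ℝ) (f : (ι → ℕ) → ℝ) (n : ι → ℕ) :
    jumpOp r f n = f n + ∑ i, r n i * (f (n + Pi.single i 1) - f n) := rfl

theorem jumpOp_apply' (r : (ι → ℕ) → ι → ℝ) (f : (ι → ℕ) → ℝ) (n : ι → ℕ) :
    jumpOp r f n = (1 - ∑ i, r n i) * f n + ∑ i, r n i * f (n + Pi.single i 1) := by
  rw [jumpOp_apply]
  simp only [mul_sub, Finset.sum_sub_distrib, ← Finset.sum_mul]
  ring

/-- The jump probabilities `r` are nonnegative with sum at most one. -/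
structure IsJumpRate (r : (ι → ℕ) → ι → ℝ) : Prop where
  nonneg : ∀ n i, 0 ≤ r n i
  sum_le_one : ∀ n, ∑ i, r n i ≤ 1

variable {r : (ι → ℕ) → ι → ℝ}

theorem IsJumpRate.jumpOp_le (hr : IsJumpRate r) {f g : (ι → ℕ) → ℝ} {n : ι → ℕ}
    (h : f n ≤ g n) (h' : ∀ i, f (n + Pi.single i 1) ≤ g (n + Pi.single i 1)) :
    jumpOp r f n ≤ jumpOp r g n := by
  rw [jumpOp_apply', jumpOp_apply']
  exact add_le_add (mul_le_mul_of_nonneg_left h (sub_nonneg.2 (hr.sum_le_one n)))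
    (Finset.sum_le_sum fun i _ => mul_le_mul_of_nonneg_left (h' i) (hr.nonneg n i))

theorem jumpOp_pow_succ_apply (t : ℕ) (f : (ι → ℕ) → ℝ) (n : ι → ℕ) :
    (jumpOp r ^ (t + 1)) f n = jumpOp r ((jumpOp r ^ t) f) n := by
  rw [pow_succ', Module.End.mul_apply]

theorem IsJumpRate.jumpOp_pow_le (hr : IsJumpRate r) {A : Set (ι → ℕ)}
    (hA : ∀ n ∈ A, ∀ i, n + Pi.single i 1 ∈ A) {f g : (ι → ℕ) → ℝ} (h : ∀ n ∈ A, f n ≤ g n)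
    (t : ℕ) : ∀ n ∈ A, (jumpOp r ^ t) f n ≤ (jumpOp r ^ t) g n := by
  induction t with
  | zero => simpa using h
  | succ t ih =>
    intro n hn
    rw [jumpOp_pow_succ_apply, jumpOp_pow_succ_apply]
    exact hr.jumpOp_le (ih n hn) fun i => ih _ (hA n hn i)

theorem IsJumpRate.jumpOp_pow_nonneg (hr : IsJumpRate r) {A : Set (ι → ℕ)}
    (hA : ∀ n ∈ A, ∀ i, n + Pi.single i 1 ∈ A) {f : (ι → ℕ) → ℝ} (h : ∀ n ∈ A, 0 ≤ f n)
    (t : ℕ) : ∀ n ∈ A, 0 ≤ (jumpOp r ^ t) f n := by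
  intro n hn
  simpa using hr.jumpOp_pow_le (f := 0) hA h t n hn

theorem jumpOp_pow_const (c : ℝ) (t : ℕ) (n : ι → ℕ) : (jumpOp r ^ t) (fun _ => c) n = c := by
  have : ∀ t : ℕ, (jumpOp r ^ t) (fun _ => c) = fun _ => c := by
    intro t
    induction t with
    | zero => simp
    | succ t ih =>
      ext n
      rw [jumpOp_pow_succ_apply, ih, jumpOp_apply]
      simp
  rw [this]

theorem tendsto_exp_neg_mul_sum_inv {δ x : ℝ} (hδ : 0 < δ) (hx : 1 ≤ x) :
    Tendsto (fun t : ℕ => Real.exp (-(δ * ∑ s ∈ Finset.range t, 1 / (x + s)))) atTop (𝓝 0) := by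
  refine Real.tendsto_exp_neg_atTop_nhds_zero.comp (Tendsto.const_mul_atTop hδ ?_)
  refine tendsto_atTop_mono (fun t => ?_)
    (Real.tendsto_sum_range_one_div_nat_succ_atTop.const_mul_atTop
      (inv_pos.2 (zero_lt_one.trans_le hx)))
  rw [Finset.mul_sum]
  refine Finset.sum_le_sum fun s _ => ?_
  have hs : (0 : ℝ) ≤ s := s.cast_nonneg
  rw [inv_mul_eq_div, div_div]
  exact one_div_le_one_div_of_le (by positivity) (by nlinarith)

/-- A Lyapunov function whose relative drift is at most `-δ / (∑ i, n i + B)` tends to zero in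
mean, since `∑ i, n i` grows at most linearly. -/
theorem IsJumpRate.tendsto_jumpOp_pow_of_drift (hr : IsJumpRate r) {A : Set (ι → ℕ)}
    (hA : ∀ n ∈ A, ∀ i, n + Pi.single i 1 ∈ A) {V : (ι → ℕ) → ℝ} (hV : ∀ n ∈ A, 0 ≤ V n)
    {δ B : ℝ} (hδ : 0 < δ) (hB : 1 ≤ B)
    (hdrift : ∀ n ∈ A, jumpOp r V n ≤ (1 - δ / (∑ i, (n i : ℝ) + B)) * V n)
    {n : ι → ℕ} (hn : n ∈ A) : Tendsto (fun t => (jumpOp r ^ t) V n) atTop (𝓝 0) := by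
  have bound : ∀ t : ℕ, ∀ n ∈ A, (jumpOp r ^ t) V n ≤
      Real.exp (-(δ * ∑ s ∈ Finset.range t, 1 / (∑ i, (n i : ℝ) + B + s))) * V n := by
    intro t
    induction t with
    | zero => simp
    | succ t ih =>
      intro n hn
      have h0 : 0 ≤ ∑ i, (n i : ℝ) := Finset.sum_nonneg fun i _ => Nat.cast_nonneg _
      set E := Real.exp (-(δ * ∑ s ∈ Finset.range t, 1 / (∑ i, (n i : ℝ) + B + (s + 1)))) with hE
      -- A jump raises the total count by at most one, so the induction hypothesis gives the same
      -- factor `E` at `n` and at all its neighbours. The drift at `n` then supplies the first term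
      -- of the harmonic sum, which `E` omits.
      have key : ∀ n' ∈ A, ∑ i, (n' i : ℝ) ≤ ∑ i, (n i : ℝ) + 1 →
          (jumpOp r ^ t) V n' ≤ (E • V) n' := by
        intro n' hn' hle
        have h0' : 0 ≤ ∑ i, (n' i : ℝ) := Finset.sum_nonneg fun i _ => Nat.cast_nonneg _
        refine (ih n' hn').trans (mul_le_mul_of_nonneg_right ?_ (hV n' hn'))
        refine Real.exp_le_exp.2 (neg_le_neg (mul_le_mul_of_nonneg_left ?_ hδ.le))
        refine Finset.sum_le_sum fun s _ => one_div_le_one_div_of_le ?_ ?_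
        · have : (0 : ℝ) ≤ s := s.cast_nonneg
          linarith
        · linarith
      rw [jumpOp_pow_succ_apply]
      calc jumpOp r ((jumpOp r ^ t) V) n ≤ jumpOp r (E • V) n := by
            refine hr.jumpOp_le (key n hn (by linarith)) fun i => key _ (hA n hn i) ?_
            simp [Finset.sum_add_distrib, Pi.single_apply]
        _ = E * jumpOp r V n := by rw [map_smul]; rfl
        _ ≤ E * ((1 - δ / (∑ i, (n i : ℝ) + B)) * V n) :=
            mul_le_mul_of_nonneg_left (hdrift n hn) (Real.exp_pos _).le
        _ ≤ E * (Real.exp (-(δ / (∑ i, (n i : ℝ) + B))) * V n) := by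
            refine mul_le_mul_of_nonneg_left (mul_le_mul_of_nonneg_right ?_ (hV n hn))
              (Real.exp_pos _).le
            exact Real.one_sub_le_exp_neg _
        _ = _ := by
            rw [← mul_assoc, hE, ← Real.exp_add, Finset.sum_range_succ']
            congr 2
            push_cast
            ring
  refine squeeze_zero (fun t => hr.jumpOp_pow_nonneg hA hV t n hn) (fun t => bound t n hn) ?_
  have h0 : 0 ≤ ∑ i, (n i : ℝ) := Finset.sum_nonneg fun i _ => Nat.cast_nonneg _
  simpa using (tendsto_exp_neg_mul_sum_inv hδ (x := ∑ i, (n i : ℝ) + B)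
    (by linarith)).mul_const (V n)

/-- Only finitely many states can be reached in `T` steps, so pointwise convergence is enough and no
domination is needed. -/
theorem tendsto_jumpOp_pow_of_pointwise {g : ℕ → (ι → ℕ) → ℝ}
    (hg : ∀ n, Tendsto (fun s => g s n) atTop (𝓝 0)) (T : ℕ) :
    ∀ n, Tendsto (fun s => (jumpOp r ^ T) (g s) n) atTop (𝓝 0) := by
  induction T with
  | zero => simpa using hg
  | succ T ih =>
    intro n
    simp only [jumpOp_pow_succ_apply, jumpOp_apply]
    simpa using (ih n).add (tendsto_finsetSum Finset.univ fun i _ =>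
      ((ih (n + Pi.single i 1)).sub (ih n)).const_mul (r n i))

/-- If the mean of a bounded function tends to zero from every starting point of a set that is
reached with probability one, then it tends to zero from every starting point. -/
theorem IsJumpRate.tendsto_jumpOp_pow_of_reached (hr : IsJumpRate r) {A : Set (ι → ℕ)}
    {h U : (ι → ℕ) → ℝ} (h0 : ∀ n, 0 ≤ h n) (h1 : ∀ n, h n ≤ 1)
    (hhA : ∀ n ∈ A, Tendsto (fun t => (jumpOp r ^ t) h n) atTop (𝓝 0))
    (hU0 : ∀ n, 0 ≤ U n) (hU1 : ∀ n, n ∉ A → 1 ≤ U n) {n : ι → ℕ}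
    (hU : Tendsto (fun t => (jumpOp r ^ t) U n) atTop (𝓝 0)) :
    Tendsto (fun t => (jumpOp r ^ t) h n) atTop (𝓝 0) := by
  classical
  have huniv : ∀ n ∈ (Set.univ : Set (ι → ℕ)), ∀ i, n + Pi.single i 1 ∈ Set.univ :=
    fun _ _ _ => Set.mem_univ _
  have hnn : ∀ t n, 0 ≤ (jumpOp r ^ t) h n := fun t n =>
    hr.jumpOp_pow_nonneg huniv (fun n _ => h0 n) t n (Set.mem_univ _)
  have hle : ∀ t n, (jumpOp r ^ t) h n ≤ 1 := fun t n =>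
    (hr.jumpOp_pow_le huniv (fun n _ => h1 n) t n (Set.mem_univ _)).trans_eq
      (jumpOp_pow_const 1 t n)
  -- The time is split as `T + s`. After the first `T` steps the chain is outside `A` with
  -- probability at most the mean of `U`; inside `A` the remaining `s` steps are estimated by `g s`,
  -- with `T` fixed.
  set g : ℕ → (ι → ℕ) → ℝ := fun s => A.indicator ((jumpOp r ^ s) h) with hg
  have hgt : ∀ n, Tendsto (fun s => g s n) atTop (𝓝 0) := by
    intro n
    by_cases hn : n ∈ A
    · simpa [hg, hn] using hhA n hn
    · simp [hg, hn]
  rw [Metric.tendsto_atTop]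
  intro e he
  obtain ⟨T, hT⟩ := (hU.eventually (gt_mem_nhds (half_pos he))).exists
  obtain ⟨s₀, hs₀⟩ := eventually_atTop.1
    ((tendsto_jumpOp_pow_of_pointwise (r := r) hgt T n).eventually (gt_mem_nhds (half_pos he)))
  refine ⟨T + s₀, fun t ht => ?_⟩
  obtain ⟨s, rfl⟩ := Nat.exists_eq_add_of_le ((Nat.le_add_right T s₀).trans ht)
  rw [Real.dist_eq, sub_zero, abs_of_nonneg (hnn _ _)]
  calc (jumpOp r ^ (T + s)) h n = (jumpOp r ^ T) ((jumpOp r ^ s) h) n := by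
        rw [pow_add, Module.End.mul_apply]
    _ ≤ (jumpOp r ^ T) (U + g s) n := by
        refine hr.jumpOp_pow_le huniv (fun n _ => ?_) T n (Set.mem_univ _)
        by_cases hn : n ∈ A
        · simpa [hg, hn] using hU0 n
        · simpa [hg, hn] using (hle s n).trans (hU1 n hn)
    _ = (jumpOp r ^ T) U n + (jumpOp r ^ T) (g s) n := by rw [map_add]; rfl
    _ < e / 2 + e / 2 := add_lt_add hT (hs₀ s (by omega))
    _ = e := add_halves e

theorem IsJumpRate.tendsto_jumpOp_pow_of_abs_sub_le (hr : IsJumpRate r) {p h : (ι → ℕ) → ℝ}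
    {m : ℝ} (hp : ∀ n, |p n - m| ≤ h n) {n : ι → ℕ}
    (hh : Tendsto (fun t => (jumpOp r ^ t) h n) atTop (𝓝 0)) :
    Tendsto (fun t => (jumpOp r ^ t) p n) atTop (𝓝 m) := by
  have huniv : ∀ n ∈ (Set.univ : Set (ι → ℕ)), ∀ i, n + Pi.single i 1 ∈ Set.univ :=
    fun _ _ _ => Set.mem_univ _
  have hm : ∀ t, (jumpOp r ^ t) p n - m = (jumpOp r ^ t) (p - fun _ => m) n := fun t => by
    rw [map_sub, Pi.sub_apply, jumpOp_pow_const]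
  rw [tendsto_iff_dist_tendsto_zero]
  refine squeeze_zero (fun _ => dist_nonneg) (fun t => ?_) hh
  rw [Real.dist_eq, hm, abs_le]
  constructor
  · rw [← Pi.neg_apply, ← map_neg]
    exact hr.jumpOp_pow_le huniv (fun k _ => (abs_le.1 (hp k)).1) t n (Set.mem_univ _)
  · exact hr.jumpOp_pow_le huniv (fun k _ => (abs_le.1 (hp k)).2) t n (Set.mem_univ _)

theorem tendsto_jumpOp_pow_sum {κ : Type*} (s : Finset κ) (c : κ → ℝ)
    {V : κ → (ι → ℕ) → ℝ} {n : ι → ℕ}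
    (hV : ∀ j ∈ s, Tendsto (fun t => (jumpOp r ^ t) (V j) n) atTop (𝓝 0)) :
    Tendsto (fun t => (jumpOp r ^ t) (∑ j ∈ s, c j • V j) n) atTop (𝓝 0) := by
  simp only [map_sum, map_smul, Finset.sum_apply, Pi.smul_apply, smul_eq_mul]
  simpa using tendsto_finsetSum s fun j hj => (hV j hj).const_mul (c j)

/-- A coordinate that jumps with probability at least proportional to its share tends to
infinity. -/
theorem IsJumpRate.tendsto_jumpOp_pow_inv (hr : IsJumpRate r) {i : ι} {a c B : ℝ} (ha : 0 < a)
    (hc : 0 < c) (hB : 1 ≤ B)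
    (hri : ∀ n, c * (a + n i) / (∑ j, (n j : ℝ) + B) ≤ r n i) (n : ι → ℕ) :
    Tendsto (fun t => (jumpOp r ^ t) (fun n => 1 / (a + n i)) n) atTop (𝓝 0) := by
  -- The relative drift carries the factor `(a + n i) / (a + n i + 1)`, which is smallest at `n i =
  -- 0`; hence `a / (a + 1)`.
  refine hr.tendsto_jumpOp_pow_of_drift (A := Set.univ) (fun _ _ _ => Set.mem_univ _)
    (fun n _ => by positivity) (δ := c * (a / (a + 1))) (by positivity) hB (fun n _ => ?_)
    (Set.mem_univ n)
  have h0 : 0 ≤ ∑ i, (n i : ℝ) := Finset.sum_nonneg fun i _ => Nat.cast_nonneg _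
  have hn : (0 : ℝ) ≤ n i := Nat.cast_nonneg _
  have hsum : jumpOp r (fun n => 1 / (a + n i)) n =
      1 / (a + n i) - r n i * (1 / ((a + n i) * (a + n i + 1))) := by
    rw [jumpOp_apply, Finset.sum_eq_single i]
    · simp only [Pi.add_apply, Pi.single_eq_same]
      push_cast
      field_simp
      ring
    · intro j _ hj
      simp [hj.symm]
    · simp
  rw [hsum, sub_mul, one_mul]
  refine sub_le_sub_left (le_trans ?_ (mul_le_mul_of_nonneg_right (hri n) (by positivity))) _
  have hB' : 0 < ∑ j, (n j : ℝ) + B := by linarith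
  have : a / (a + 1) ≤ (a + n i) / (a + n i + 1) := by
    rw [div_le_div_iff₀ (by positivity) (by positivity)]
    nlinarith
  calc c * (a / (a + 1)) / (∑ j, (n j : ℝ) + B) * (1 / (a + n i))
      ≤ c * ((a + n i) / (a + n i + 1)) / (∑ j, (n j : ℝ) + B) * (1 / (a + n i)) := by gcongr
    _ = _ := by field_simp

end JumpChain

/-! ### Linearly reinforced chains with a dominant coordinate -/

/-- Replaces the weighted denominators of the jump rates by the total count required in the drift
criterion. -/
theorem sum_mul_natCast_add_le {ι : Type*} [Fintype ι] {v : ι → ℝ} {b : ℝ}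
    (hv : ∀ i, 0 ≤ v i) (hb : 0 ≤ b)
    (n : ι → ℕ) :
    ∑ i, v i * n i + b ≤ (∑ i, v i + b) * (∑ i, (n i : ℝ) + 1) := by
  have h0 : 0 ≤ ∑ i, (n i : ℝ) := Finset.sum_nonneg fun i _ => Nat.cast_nonneg _
  have h1 : ∑ i, v i * n i ≤ (∑ i, v i) * ∑ i, (n i : ℝ) := by
    rw [Finset.sum_mul]
    refine Finset.sum_le_sum fun i _ => mul_le_mul_of_nonneg_left ?_ (hv i)
    exact Finset.single_le_sum (f := fun i => (n i : ℝ)) (fun i _ => Nat.cast_nonneg _)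
      (Finset.mem_univ i)
  have h2 : 0 ≤ ∑ i, v i := Finset.sum_nonneg fun i _ => hv i
  nlinarith [mul_nonneg hb h0]

section Dominant

variable {ι : Type*} [Fintype ι] [DecidableEq ι] {r : (ι → ℕ) → ι → ℝ}

/-- In a linearly reinforced chain, the share of a coordinate `j` relative to a coordinate `i₀` with
a larger reinforcement tends to zero, once the count of `i₀` is large. -/
theorem IsJumpRate.tendsto_jumpOp_pow_ratio (hr : IsJumpRate r) {i₀ j : ι} {α b c v : ι → ℝ}
    (hα : ∀ i, 0 < α i) (hb : ∀ i, 0 < b i) (hv : ∀ i, 0 ≤ v i) (hv₀ : 0 < v i₀)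
    (hc : ∀ i, 0 ≤ c i) (hj : j ≠ i₀) (hdom : c j < c i₀)
    (hrate : ∀ n i, r n i = c i * (α i + n i) / (∑ j, v j * n j + b i)) :
    ∀ᶠ N : ℕ in atTop, ∀ n : ι → ℕ, N ≤ n i₀ →
      Tendsto (fun t => (jumpOp r ^ t) (fun n => (α j + n j) / (α i₀ + n i₀ - 1)) n)
        atTop (𝓝 0) := by
  -- The rates of `j` and `i₀` have different constants `b` in their denominators. For `n i₀ ≥ N`
  -- this difference costs at most half of the gap `c i₀ - c j`; the other half is the drift.
  have hev : ∀ᶠ N : ℕ in atTop, c j * b i₀ ≤ (c i₀ - c j) / 2 * v i₀ * (N : ℝ) :=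
    (tendsto_natCast_atTop_atTop.const_mul_atTop
      (mul_pos (half_pos (sub_pos.2 hdom)) hv₀)).eventually_ge_atTop _
  filter_upwards [hev, eventually_ge_atTop 1] with N hN hN1 n hn
  have hΛ : 0 < ∑ i, v i + b i₀ :=
    add_pos_of_nonneg_of_pos (Finset.sum_nonneg fun i _ => hv i) (hb i₀)
  refine hr.tendsto_jumpOp_pow_of_drift (A := {n | N ≤ n i₀}) (fun n hn i => ?_) (fun n hn => ?_)
    (δ := (c i₀ - c j) / 2 / (∑ i, v i + b i₀)) (div_pos (half_pos (sub_pos.2 hdom)) hΛ) le_rfl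
    (fun n hn => ?_) hn
  · exact Nat.le_trans (show N ≤ n i₀ from hn) (Nat.le_add_right (n i₀) _)
  all_goals
    have hn₀ : (N : ℝ) ≤ n i₀ := Nat.cast_le.2 hn
    have hN1' : (1 : ℝ) ≤ N := by exact_mod_cast hN1
    have hx : 0 < α i₀ + n i₀ - 1 := by linarith [hα i₀]
    have hjpos : 0 < α j + n j := add_pos_of_pos_of_nonneg (hα j) (Nat.cast_nonneg _)
  · exact (div_pos hjpos hx).le
  set x := α i₀ + n i₀ - 1 with hxdef
  set S := ∑ i, v i * (n i : ℝ) with hS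
  have hS0 : v i₀ * n i₀ ≤ S :=
    Finset.single_le_sum (f := fun i => v i * (n i : ℝ))
      (fun i _ => mul_nonneg (hv i) (Nat.cast_nonneg _)) (Finset.mem_univ i₀)
  have hSnn : 0 ≤ S := le_trans (mul_nonneg hv₀.le (Nat.cast_nonneg _)) hS0
  have hSj : 0 < S + b j := add_pos_of_nonneg_of_pos hSnn (hb j)
  have hS₀ : 0 < S + b i₀ := add_pos_of_nonneg_of_pos hSnn (hb i₀)
  -- The `-1` in the denominator makes the drift exact: a jump of `i₀` changes `1 / x` by `-1 / (x *
  -- (x + 1))`, and its rate is proportional to `α i₀ + n i₀ = x + 1`.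
  have hstep : jumpOp r (fun n => (α j + n j) / (α i₀ + n i₀ - 1)) n =
      (1 + c j / (S + b j) - c i₀ / (S + b i₀)) * ((α j + n j) / x) := by
    rw [jumpOp_apply, Finset.sum_eq_add j i₀ hj]
    · have h1 : α i₀ + ((n i₀ : ℝ) + 1) - 1 = x + 1 := by rw [hxdef]; ring
      have h2 : r n i₀ = c i₀ * (x + 1) / (S + b i₀) := by rw [hrate, hxdef]; ring
      have h3 : r n j = c j * (α j + n j) / (S + b j) := hrate n j
      simp only [Pi.add_apply, Pi.single_eq_same, Pi.single_eq_of_ne hj,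
        Pi.single_eq_of_ne hj.symm, add_zero, Nat.cast_add, Nat.cast_one, h1, h2, h3, ← hxdef]
      have hx1 : x + 1 ≠ 0 := by linarith
      field_simp
      ring
    · intro i _ hi
      simp [Pi.single_eq_of_ne hi.1.symm, Pi.single_eq_of_ne hi.2.symm]
    · simp
    · simp
  rw [hstep]
  refine mul_le_mul_of_nonneg_right ?_ (div_pos hjpos hx).le
  have hA : c j / (S + b j) ≤ (c j + (c i₀ - c j) / 2) / (S + b i₀) := by
    rw [div_le_div_iff₀ hSj hS₀]
    have h1 : (c i₀ - c j) / 2 * v i₀ * N ≤ (c i₀ - c j) / 2 * S := by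
      rw [mul_assoc]
      exact mul_le_mul_of_nonneg_left
        ((mul_le_mul_of_nonneg_left hn₀ hv₀.le).trans hS0) (half_pos (sub_pos.2 hdom)).le
    nlinarith [mul_nonneg (hc j) (hb j).le, mul_pos (half_pos (sub_pos.2 hdom)) (hb j)]
  have hB : (c i₀ - c j) / 2 / (∑ i, v i + b i₀) / (∑ i, (n i : ℝ) + 1) ≤
      (c i₀ - c j) / 2 / (S + b i₀) := by
    rw [div_div]
    exact div_le_div_of_nonneg_left (half_pos (sub_pos.2 hdom)).le hS₀
      (sum_mul_natCast_add_le hv (hb i₀).le n)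
  have hC : c i₀ / (S + b i₀) =
      (c j + (c i₀ - c j) / 2) / (S + b i₀) + (c i₀ - c j) / 2 / (S + b i₀) := by
    rw [← add_div]
    congr 1
    ring
  linarith

/-- In a linearly reinforced chain with a dominant coordinate, asymptotically all jumps are those of
the dominant coordinate. -/
theorem IsJumpRate.tendsto_jumpOp_pow_of_dominant (hr : IsJumpRate r) {i₀ : ι}
    {α b c v : ι → ℝ} {m : ℝ} (hα : ∀ i, 0 < α i) (hb : ∀ i, 0 < b i) (hv : ∀ i, 0 ≤ v i)
    (hv₀ : 0 < v i₀) (hc : ∀ i, 0 ≤ c i) (hm : 0 < m) (hm1 : m ≤ 1) (hcm : c i₀ = m * v i₀)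
    (hb₀ : v i₀ * α i₀ ≤ b i₀) (hdom : ∀ j, j ≠ i₀ → c j < c i₀)
    (hrate : ∀ n i, r n i = c i * (α i + n i) / (∑ j, v j * n j + b i)) (n : ι → ℕ) :
    Tendsto (fun t => (jumpOp r ^ t) (fun n => ∑ i, r n i) n) atTop (𝓝 m) := by
  have hSnn : ∀ n : ι → ℕ, 0 ≤ ∑ i, v i * (n i : ℝ) := fun n =>
    Finset.sum_nonneg fun i _ => mul_nonneg (hv i) (Nat.cast_nonneg _)
  have hinv : ∀ n, Tendsto (fun t => (jumpOp r ^ t) (fun n => 1 / (α i₀ + n i₀)) n)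
      atTop (𝓝 0) := by
    have hΛ : 0 < ∑ i, v i + b i₀ :=
      add_pos_of_nonneg_of_pos (Finset.sum_nonneg fun i _ => hv i) (hb i₀)
    refine hr.tendsto_jumpOp_pow_inv (c := c i₀ / (∑ i, v i + b i₀)) (hα i₀)
      (div_pos (hcm ▸ mul_pos hm hv₀) hΛ) le_rfl fun n => ?_
    rw [hrate, div_mul_eq_mul_div, div_div]
    exact div_le_div_of_nonneg_left
      (mul_nonneg (hc i₀) (add_nonneg (hα i₀).le (Nat.cast_nonneg _)))
      (add_pos_of_nonneg_of_pos (hSnn n) (hb i₀)) (sum_mul_natCast_add_le hv (hb i₀).le n)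
  have hratio : ∀ᶠ N : ℕ in atTop, ∀ j ∈ Finset.univ.erase i₀, ∀ n : ι → ℕ, N ≤ n i₀ →
      Tendsto (fun t => (jumpOp r ^ t) (fun n => (α j + n j) / (α i₀ + n i₀ - 1)) n)
        atTop (𝓝 0) :=
    (Finset.eventually_all _).2 fun j hj => hr.tendsto_jumpOp_pow_ratio hα hb hv hv₀ hc
      (Finset.ne_of_mem_erase hj) (hdom j (Finset.ne_of_mem_erase hj)) hrate
  obtain ⟨N, hN, hN1⟩ := (hratio.and (eventually_ge_atTop 1)).exists
  have hA : ∀ n ∈ {n : ι → ℕ | N ≤ n i₀}, ∀ i, n + Pi.single i 1 ∈ {n : ι → ℕ | N ≤ n i₀} :=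
    fun n hn i => Nat.le_trans (show N ≤ n i₀ from hn) (Nat.le_add_right (n i₀) _)
  refine hr.tendsto_jumpOp_pow_of_abs_sub_le (h := fun n => |∑ i, r n i - m|) (fun _ => le_rfl) ?_
  -- `U` is scaled to be at least one while `n i₀ < N`, and its mean tends to zero because `n i₀`
  -- grows.
  refine hr.tendsto_jumpOp_pow_of_reached (A := {n | N ≤ n i₀})
    (U := (α i₀ + N) • fun n => 1 / (α i₀ + n i₀)) (fun n => abs_nonneg _) (fun n => ?_)
    (fun n hn => ?_) (fun n => ?_) (fun n hn => ?_) ?_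
  · have h0 : 0 ≤ ∑ i, r n i := Finset.sum_nonneg fun i _ => hr.nonneg n i
    have h1 := hr.sum_le_one n
    exact abs_le.2 ⟨by linarith, by linarith⟩
  -- `G` bounds both contributions to the error: the deficit of `r n i₀` below `m`, and the rates of
  -- the other coordinates. Its last summand accounts for the constant mass in the denominator that
  -- does not belong to `i₀`.
  · set G : (ι → ℕ) → ℝ := (∑ j ∈ Finset.univ.erase i₀, (m * v j / v i₀ +
        c j * (α i₀ + 1) / v i₀) • fun n : ι → ℕ => (α j + n j) / (α i₀ + n i₀ - 1)) +
        (m * (b i₀ - v i₀ * α i₀) / v i₀) • fun n : ι → ℕ => 1 / (α i₀ + n i₀) with hG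
    have hGt : Tendsto (fun t => (jumpOp r ^ t) G n) atTop (𝓝 0) := by
      simp only [hG, map_add, Pi.add_apply]
      rw [← add_zero (0 : ℝ)]
      refine (tendsto_jumpOp_pow_sum _ _ fun j hj => hN j hj n hn).add ?_
      simp only [map_smul, Pi.smul_apply, smul_eq_mul]
      simpa using (hinv n).const_mul (m * (b i₀ - v i₀ * α i₀) / v i₀)
    refine squeeze_zero (fun t => hr.jumpOp_pow_nonneg hA (fun n _ => abs_nonneg _) t n hn)
      (fun t => hr.jumpOp_pow_le hA (fun n hn => ?_) t n hn) hGt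
    have hn₀ : (1 : ℝ) ≤ n i₀ := by exact_mod_cast hN1.trans hn
    have hα₀ := hα i₀
    have hx : 0 < α i₀ + n i₀ - 1 := by linarith
    have hsplit := Finset.add_sum_erase Finset.univ (fun i => v i * (n i : ℝ))
      (Finset.mem_univ i₀)
    have hE0 : 0 ≤ ∑ j ∈ Finset.univ.erase i₀, v j * (n j : ℝ) :=
      Finset.sum_nonneg fun i _ => mul_nonneg (hv i) (Nat.cast_nonneg _)
    have hden : 0 < ∑ i, v i * (n i : ℝ) + b i₀ := add_pos_of_nonneg_of_pos (hSnn n) (hb i₀)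
    have hmr : m - r n i₀ = m * (∑ j ∈ Finset.univ.erase i₀, v j * (n j : ℝ) +
        (b i₀ - v i₀ * α i₀)) / (∑ i, v i * (n i : ℝ) + b i₀) := by
      rw [hrate, hcm, eq_div_iff hden.ne', sub_mul, div_mul_cancel₀ _ hden.ne', ← hsplit]
      ring
    have hmr0 : 0 ≤ m - r n i₀ := by
      rw [hmr]
      exact div_nonneg (mul_nonneg hm.le (add_nonneg hE0 (sub_nonneg.2 hb₀))) hden.le
    have hr1 : m - r n i₀ ≤ ∑ j ∈ Finset.univ.erase i₀,
        m * v j / v i₀ * ((α j + n j) / (α i₀ + n i₀ - 1)) +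
        m * (b i₀ - v i₀ * α i₀) / v i₀ * (1 / (α i₀ + n i₀)) := by
      have hpos : 0 < v i₀ * (α i₀ + n i₀) := mul_pos hv₀ (by linarith)
      calc m - r n i₀ ≤ m * (∑ j ∈ Finset.univ.erase i₀, v j * (n j : ℝ) +
          (b i₀ - v i₀ * α i₀)) / (v i₀ * (α i₀ + n i₀)) := by
            rw [hmr]
            exact div_le_div_of_nonneg_left
              (mul_nonneg hm.le (add_nonneg hE0 (sub_nonneg.2 hb₀))) hpos (by linarith)
        _ = ∑ j ∈ Finset.univ.erase i₀, m * v j / v i₀ * (n j / (α i₀ + n i₀)) +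
            m * (b i₀ - v i₀ * α i₀) / v i₀ * (1 / (α i₀ + n i₀)) := by
            rw [mul_add, add_div, Finset.mul_sum, Finset.sum_div]
            congr 1
            · exact Finset.sum_congr rfl fun j _ => by field_simp
            · field_simp
        _ ≤ _ := by
            refine add_le_add_left (Finset.sum_le_sum fun j _ => ?_) _
            refine mul_le_mul_of_nonneg_left ?_ (div_nonneg (mul_nonneg hm.le (hv j)) hv₀.le)
            exact div_le_div₀ (add_nonneg (hα j).le (Nat.cast_nonneg _))
              (by linarith [hα j]) hx (by linarith)
    have hr2 : ∀ j, r n j ≤ c j * (α i₀ + 1) / v i₀ * ((α j + n j) / (α i₀ + n i₀ - 1)) := by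
      intro j
      have hj : 0 ≤ c j * (α j + n j) :=
        mul_nonneg (hc j) (add_nonneg (hα j).le (Nat.cast_nonneg _))
      calc r n j ≤ c j * (α j + n j) / (v i₀ * ((α i₀ + n i₀ - 1) / (α i₀ + 1))) := by
            rw [hrate]
            refine div_le_div_of_nonneg_left hj (by positivity) ?_
            -- Since `n i₀ ≥ 1`, the count itself is comparable to the shifted denominator of the
            -- ratio; this is the origin of the factor `α i₀ + 1` in `G`.
            have h1 : (α i₀ + n i₀ - 1) / (α i₀ + 1) ≤ n i₀ := by
              rw [div_le_iff₀ (by linarith)]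
              nlinarith
            have h2 := mul_le_mul_of_nonneg_left h1 hv₀.le
            linarith [hb j]
        _ = _ := by field_simp
    have hGn : G n = (∑ j ∈ Finset.univ.erase i₀,
        m * v j / v i₀ * ((α j + n j) / (α i₀ + n i₀ - 1)) +
        m * (b i₀ - v i₀ * α i₀) / v i₀ * (1 / (α i₀ + n i₀))) +
        ∑ j ∈ Finset.univ.erase i₀,
          c j * (α i₀ + 1) / v i₀ * ((α j + n j) / (α i₀ + n i₀ - 1)) := by
      simp only [hG, Pi.add_apply, Finset.sum_apply, Pi.smul_apply, smul_eq_mul, add_mul,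
        Finset.sum_add_distrib]
      ring
    rw [hGn, ← Finset.add_sum_erase Finset.univ (fun i => r n i) (Finset.mem_univ i₀)]
    have h3 : ∑ j ∈ Finset.univ.erase i₀, r n j ≤ _ := Finset.sum_le_sum fun j _ => hr2 j
    have h4 : 0 ≤ ∑ j ∈ Finset.univ.erase i₀, r n j :=
      Finset.sum_nonneg fun j _ => hr.nonneg n j
    exact abs_le.2 ⟨by linarith, by linarith⟩
  · have := hα i₀
    simp only [Pi.smul_apply, smul_eq_mul]
    positivity
  · have h1 : (n i₀ : ℝ) ≤ N := by exact_mod_cast (not_le.1 hn).le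
    have h2 : 0 < α i₀ + n i₀ := add_pos_of_pos_of_nonneg (hα i₀) (Nat.cast_nonneg _)
    simp only [Pi.smul_apply, smul_eq_mul, mul_one_div]
    rw [one_le_div h2]
    linarith
  · simp only [map_smul, Pi.smul_apply, smul_eq_mul]
    simpa using (hinv n).const_mul (α i₀ + N)

end Dominant

/-! ### Markets in which class `k` buys only item `k` -/

theorem PMF.toReal_bind_apply {α β : Type*} [Fintype α] (p : PMF α) (f : α → PMF β) (b : β) :
    (p.bind f b).toReal = ∑ a, (p a).toReal * (f a b).toReal := by
  rw [PMF.bind_apply, tsum_fintype, ENNReal.toReal_sum fun a _ =>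
    ENNReal.mul_ne_top (p.apply_ne_top a) ((f a).apply_ne_top b)]
  simp only [ENNReal.toReal_mul]

namespace MMNL

/-! ### Expectations under the model's laws as finite sums -/

section General

variable {N K : ℕ} (M : MMNL N K)

theorem toReal_buyLaw_bind (k : Fin K) (i : Fin N) {β : Type*} (f : Bool → PMF β) (b : β) :
    ((M.buyLaw k i).bind f b).toReal =
      M.quality i k * (f true b).toReal + (1 - M.quality i k) * (f false b).toReal := by
  rw [PMF.toReal_bind_apply, Fintype.sum_bool]
  simp only [buyLaw, PMF.ofFintype_apply, cond_true, cond_false,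
    ENNReal.toReal_ofReal (M.quality_nonneg i k),
    ENNReal.toReal_ofReal (sub_nonneg.2 (M.quality_le_one i k))]

theorem toReal_tryLaw_bind (σ : Equiv.Perm (Fin N)) (d : Fin N → ℕ) (k : Fin K) {β : Type*}
    (f : Option (Fin N) → PMF β) (b : β) :
    ((M.tryLaw σ d k).bind f b).toReal = (1 - ∑ i, M.tryProb σ d k i) * (f none b).toReal +
      ∑ i, M.tryProb σ d k i * (f (some i) b).toReal := by
  rw [PMF.toReal_bind_apply, Fintype.sum_option]
  simp only [tryLaw, PMF.ofFintype_apply, Option.elim_none, Option.elim_some,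
    ENNReal.toReal_ofReal (M.tryProb_nonneg σ d k _),
    ENNReal.toReal_ofReal (sub_nonneg.2 (M.sum_tryProb_le_one σ d k))]

theorem toReal_purchaseLaw_bind (σ : Equiv.Perm (Fin N)) (d : Fin N → ℕ) (k : Fin K)
    {β : Type*} (f : Option (Fin N) → PMF β) (b : β) :
    ((M.purchaseLaw σ d k).bind f b).toReal = (f none b).toReal +
      ∑ i, M.tryProb σ d k i * M.quality i k * ((f (some i) b).toReal - (f none b).toReal) := by
  rw [purchaseLaw, PMF.bind_bind, toReal_tryLaw_bind]
  simp only [Option.elim_none, Option.elim_some, PMF.pure_bind, PMF.bind_map,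
    toReal_buyLaw_bind, Function.comp_apply, if_true, Bool.false_eq_true, if_false]
  rw [sub_mul, one_mul, Finset.sum_mul, sub_add_eq_add_sub, add_sub_assoc,
    ← Finset.sum_sub_distrib]
  congr 1
  exact Finset.sum_congr rfl fun i _ => by ring

theorem toReal_arrivalLaw (k : Fin K) : (M.arrivalLaw k).toReal = M.weight k := by
  rw [arrivalLaw, PMF.ofFintype_apply, ENNReal.toReal_ofReal (M.weight_nonneg k)]

theorem toReal_consumerLaw_bind (τ : Fin K → Equiv.Perm (Fin N))
    (signal : (Fin K → Fin N → ℕ) → Fin K → Fin N → ℕ) (D : Fin K → Fin N → ℕ)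
    {β : Type*} (f : Fin K × Option (Fin N) → PMF β) (b : β) :
    ((M.consumerLaw τ signal D).bind f b).toReal =
      ∑ k, M.weight k * ((f (k, none) b).toReal +
        ∑ i, M.tryProb (τ k) (signal D k) k i * M.quality i k *
          ((f (k, some i) b).toReal - (f (k, none) b).toReal)) := by
  rw [consumerLaw, PMF.bind_bind, PMF.toReal_bind_apply]
  simp only [PMF.bind_map, toReal_purchaseLaw_bind, Function.comp_apply, toReal_arrivalLaw]

/-- The backward form of the Markov chain: the one-step operator acts on the observable `f` instead
of on the law, so induction on `t` can let `f` vary. -/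
theorem countsLaw_bind (τ : Fin K → Equiv.Perm (Fin N))
    (signal : (Fin K → Fin N → ℕ) → Fin K → Fin N → ℕ) {β : Type*} (t : ℕ)
    (f : (Fin K → Fin N → ℕ) → PMF β) :
    (M.countsLaw τ signal t).bind f = ((fun (g : (Fin K → Fin N → ℕ) → PMF β) D =>
      (M.consumerLaw τ signal D).bind fun c => g (recordPurchase D c))^[t] f) 0 := by
  induction t generalizing f with
  | zero => simp [countsLaw]
  | succ t ih =>
    rw [Function.iterate_succ_apply, ← ih, countsLaw, PMF.bind_bind]
    simp only [PMF.bind_map]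
    rfl

end General

/-! ### Reduction to a jump chain, and the limits under both signals -/

section Diagonal

variable {K : ℕ}

/-- The purchase counts when each class `k` has bought item `k` exactly `n k` times. -/
def diagCounts (n : Fin K → ℕ) : Fin K → Fin K → ℕ := fun k => Pi.single k (n k)

theorem diagCounts_zero : diagCounts (0 : Fin K → ℕ) = 0 := by
  ext k i
  simp [diagCounts]

theorem globalSignal_diagCounts (n : Fin K → ℕ) (k : Fin K) :
    globalSignal (diagCounts n) k = n := by
  ext i
  simp [globalSignal, diagCounts, Pi.single_apply]

theorem recordPurchase_none {N : ℕ} {D : Fin K → Fin N → ℕ} (k : Fin K) :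
    recordPurchase D (k, none) = D := by
  ext
  simp [recordPurchase]

theorem recordPurchase_diagCounts (n : Fin K → ℕ) (k : Fin K) :
    recordPurchase (diagCounts n) (k, some k) = diagCounts (n + Pi.single k 1) := by
  ext l i
  simp only [recordPurchase, diagCounts, Pi.single_apply, Pi.add_apply, Option.some.injEq]
  split_ifs <;> simp_all

variable (M : MMNL K K)

/-- The probability that the next purchase is one of item `k` by class `k`, when each class `l` has
bought item `l` exactly `n l` times and no other purchase has been made. -/
noncomputable def diagRate (τ : Fin K → Equiv.Perm (Fin K))
    (signal : (Fin K → Fin K → ℕ) → Fin K → Fin K → ℕ) (n : Fin K → ℕ) (k : Fin K) : ℝ :=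
  M.weight k * M.quality k k * M.tryProb (τ k) (signal (diagCounts n) k) k k

theorem isJumpRate_diagRate (τ : Fin K → Equiv.Perm (Fin K))
    (signal : (Fin K → Fin K → ℕ) → Fin K → Fin K → ℕ) : IsJumpRate (M.diagRate τ signal) where
  nonneg n k := mul_nonneg (mul_nonneg (M.weight_nonneg k) (M.quality_nonneg k k))
    (M.tryProb_nonneg _ _ _ _)
  sum_le_one n := by
    rw [← M.sum_weight]
    refine Finset.sum_le_sum fun k _ => ?_
    rw [diagRate, mul_assoc]
    refine mul_le_of_le_one_right (M.weight_nonneg k)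
      (mul_le_one₀ (M.quality_le_one k k) (M.tryProb_nonneg _ _ _ _) ?_)
    exact (Finset.single_le_sum (f := M.tryProb (τ k) (signal (diagCounts n) k) k)
      (fun i _ => M.tryProb_nonneg _ _ _ i) (Finset.mem_univ k)).trans
      (M.sum_tryProb_le_one _ _ _)

variable {M}

theorem toReal_consumerLaw_bind_of_diag (hq : ∀ i k, i ≠ k → M.quality i k = 0)
    (τ : Fin K → Equiv.Perm (Fin K))
    (signal : (Fin K → Fin K → ℕ) → Fin K → Fin K → ℕ) (n : Fin K → ℕ)
    {β : Type*} (f : Fin K × Option (Fin K) → PMF β) (b : β) :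
    ((M.consumerLaw τ signal (diagCounts n)).bind f b).toReal =
      ∑ k, M.weight k * (f (k, none) b).toReal +
        ∑ k, M.diagRate τ signal n k * ((f (k, some k) b).toReal - (f (k, none) b).toReal) := by
  rw [toReal_consumerLaw_bind, ← Finset.sum_add_distrib]
  refine Finset.sum_congr rfl fun k _ => ?_
  rw [Finset.sum_eq_single k (fun i _ hi => by rw [hq i k hi]; ring) (by simp), diagRate]
  ring

/-- The diagonal states are closed under the dynamics, so the backward operator restricted to them
is `jumpOp`. -/
theorem toReal_iterate_consumerLaw_bind (hq : ∀ i k, i ≠ k → M.quality i k = 0)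
    (τ : Fin K → Equiv.Perm (Fin K))
    (signal : (Fin K → Fin K → ℕ) → Fin K → Fin K → ℕ) {β : Type*} (b : β) (t : ℕ)
    (f : (Fin K → Fin K → ℕ) → PMF β) (φ : (Fin K → ℕ) → ℝ)
    (hφ : ∀ n, (f (diagCounts n) b).toReal = φ n) (n : Fin K → ℕ) :
    (((fun (g : (Fin K → Fin K → ℕ) → PMF β) D =>
      (M.consumerLaw τ signal D).bind fun c => g (recordPurchase D c))^[t] f)
        (diagCounts n) b).toReal = (jumpOp (M.diagRate τ signal) ^ t) φ n := by
  induction t generalizing f φ with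
  | zero => simpa using hφ n
  | succ t ih =>
    rw [Function.iterate_succ_apply, pow_succ, Module.End.mul_apply]
    refine ih _ _ fun n => ?_
    rw [toReal_consumerLaw_bind_of_diag hq, jumpOp_apply]
    simp only [recordPurchase_none, recordPurchase_diagCounts, hφ]
    rw [← Finset.sum_mul, M.sum_weight, one_mul]

theorem purchaseProb_eq_jumpOp_pow (hq : ∀ i k, i ≠ k → M.quality i k = 0)
    (τ : Fin K → Equiv.Perm (Fin K))
    (signal : (Fin K → Fin K → ℕ) → Fin K → Fin K → ℕ) (t : ℕ) :
    M.purchaseProb τ signal t =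
      (jumpOp (M.diagRate τ signal) ^ t) (fun n => ∑ k, M.diagRate τ signal n k) 0 := by
  rw [purchaseProb, PMF.map_bind, countsLaw_bind, ← diagCounts_zero]
  refine toReal_iterate_consumerLaw_bind hq τ signal true t _ _ (fun n => ?_) 0
  rw [← PMF.bind_pure_comp, toReal_consumerLaw_bind_of_diag hq]
  simp

theorem weight_pos (k : Fin K) : 0 < M.weight k :=
  div_pos (M.rate_pos k) (Finset.sum_pos (fun l _ => M.rate_pos l) ⟨k, Finset.mem_univ k⟩)

theorem weight_le_one (k : Fin K) : M.weight k ≤ 1 := by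
  rw [← M.sum_weight]
  exact Finset.single_le_sum (fun l _ => M.weight_nonneg l) (Finset.mem_univ k)

/-- With segmented popularity signals, class `k` eventually always tries the item it may buy. -/
theorem tendsto_probSQSSI_of_diag (hq : ∀ i k, i ≠ k → M.quality i k = 0)
    (hpos : ∀ k, 0 < M.quality k k) {τ : Fin K → Equiv.Perm (Fin K)}
    (hτ : ∀ k, 0 < M.vis (τ k k)) :
    Tendsto (fun t => M.probSQSSI τ t) atTop (𝓝 (∑ k, M.weight k * M.quality k k)) := by
  simp only [probSQSSI, purchaseProb_eq_jumpOp_pow hq]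
  set r := M.diagRate τ classSignal with hrdef
  have hr : IsJumpRate r := M.isJumpRate_diagRate τ classSignal
  -- The mass competing with item `k` in the eyes of class `k` is constant in time, as this class
  -- never buys another item.
  set b : Fin K → ℝ := fun k =>
    ∑ j ∈ Finset.univ.erase k, M.vis (τ k j) * M.appeal j k + M.z with hb
  have hb0 : ∀ k, 0 ≤ b k := fun k => add_nonneg
    (Finset.sum_nonneg fun j _ => mul_nonneg (M.vis_nonneg _) (M.appeal_pos j k).le) M.z_nonneg
  have hrate : ∀ n k, r n k = M.weight k * M.quality k k *
      (M.vis (τ k k) * (M.appeal k k + n k) /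
        (M.vis (τ k k) * (M.appeal k k + n k) + b k)) := by
    intro n k
    have h : ∑ j, M.vis (τ k j) * (M.appeal j k + (Pi.single k (n k) : Fin K → ℕ) j) =
        M.vis (τ k k) * (M.appeal k k + n k) +
          ∑ j ∈ Finset.univ.erase k, M.vis (τ k j) * M.appeal j k := by
      rw [← Finset.add_sum_erase _ _ (Finset.mem_univ k), Pi.single_eq_same]
      congr 1
      refine Finset.sum_congr rfl fun j hj => ?_
      rw [Pi.single_eq_of_ne (Finset.ne_of_mem_erase hj), Nat.cast_zero, add_zero]
    rw [hrdef, diagRate, tryProb]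
    simp only [classSignal, diagCounts, h, Pi.single_eq_same, hb, add_assoc]
  refine hr.tendsto_jumpOp_pow_of_abs_sub_le
    (h := ∑ k, (M.weight k * M.quality k k * b k / M.vis (τ k k)) •
      fun n : Fin K → ℕ => 1 / (M.appeal k k + n k)) (fun n => ?_)
    (tendsto_jumpOp_pow_sum _ _ fun k _ => ?_)
  · rw [← Finset.sum_sub_distrib]
    refine (Finset.abs_sum_le_sum_abs _ _).trans ?_
    simp only [Finset.sum_apply, Pi.smul_apply, smul_eq_mul]
    refine Finset.sum_le_sum fun k _ => ?_
    have hw : 0 < M.weight k * M.quality k k := mul_pos (weight_pos k) (hpos k)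
    have ha : 0 < M.appeal k k + n k :=
      add_pos_of_pos_of_nonneg (M.appeal_pos k k) (Nat.cast_nonneg _)
    have hva := mul_pos (hτ k) ha
    have hden : 0 < M.vis (τ k k) * (M.appeal k k + n k) + b k :=
      add_pos_of_pos_of_nonneg hva (hb0 k)
    have heq : r n k - M.weight k * M.quality k k = -(M.weight k * M.quality k k * b k /
        (M.vis (τ k k) * (M.appeal k k + n k) + b k)) := by
      rw [hrate]
      field_simp
      ring
    rw [heq, abs_neg, abs_of_nonneg (div_nonneg (mul_nonneg hw.le (hb0 k)) hden.le),
      div_mul_div_comm, mul_one]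
    exact div_le_div_of_nonneg_left (mul_nonneg hw.le (hb0 k)) hva
      (le_add_of_nonneg_right (hb0 k))
  · have hw : 0 < M.weight k * M.quality k k := mul_pos (weight_pos k) (hpos k)
    have hv := hτ k
    -- After division by the visibility, the denominator is `appeal + n k + b k / vis`, at most `∑ n
    -- + B`; the `+ 1` only ensures `1 ≤ B`.
    set B := M.appeal k k + b k / M.vis (τ k k) + 1 with hB
    have hdiv : 0 ≤ b k / M.vis (τ k k) := div_nonneg (hb0 k) hv.le
    have ha := M.appeal_pos k k
    refine hr.tendsto_jumpOp_pow_inv ha hw (B := B) (by linarith) (fun n => ?_) 0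
    have hn : (n k : ℝ) ≤ ∑ j, (n j : ℝ) := Finset.single_le_sum (f := fun j => (n j : ℝ))
      (fun j _ => Nat.cast_nonneg _) (Finset.mem_univ k)
    have hnk : (0 : ℝ) ≤ n k := Nat.cast_nonneg _
    have h1 : M.vis (τ k k) * (M.appeal k k + n k) /
        (M.vis (τ k k) * (M.appeal k k + n k) + b k) =
        (M.appeal k k + n k) / (M.appeal k k + n k + b k / M.vis (τ k k)) := by
      have : M.vis (τ k k) * (M.appeal k k + n k) + b k =
          M.vis (τ k k) * (M.appeal k k + n k + b k / M.vis (τ k k)) := by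
        field_simp
      rw [this, mul_div_mul_left _ _ hv.ne']
    rw [hrate, h1, mul_div_assoc]
    refine mul_le_mul_of_nonneg_left ?_ hw.le
    exact div_le_div_of_nonneg_left (by linarith) (by linarith) (by rw [hB]; linarith)

/-- With the global popularity signal, the market goes to a monopoly of the item that maximizes
average quality times visibility. -/
theorem tendsto_probAQGSI_of_diag (hq : ∀ i k, i ≠ k → M.quality i k = 0)
    {σ : Equiv.Perm (Fin K)} {i₀ : Fin K} (hv : 0 < M.vis (σ i₀)) (hpos : 0 < M.quality i₀ i₀)
    (hdom : ∀ i, i ≠ i₀ → M.weight i * M.quality i i * M.vis (σ i) <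
      M.weight i₀ * M.quality i₀ i₀ * M.vis (σ i₀)) :
    Tendsto (fun t => M.probAQGSI σ t) atTop (𝓝 (M.weight i₀ * M.quality i₀ i₀)) := by
  simp only [probAQGSI, purchaseProb_eq_jumpOp_pow hq]
  have hnn : ∀ j k, 0 ≤ M.vis (σ j) * M.appeal j k := fun j k =>
    mul_nonneg (M.vis_nonneg _) (M.appeal_pos j k).le
  refine (M.isJumpRate_diagRate _ globalSignal).tendsto_jumpOp_pow_of_dominant (i₀ := i₀)
    (α := fun i => M.appeal i i) (b := fun i => ∑ j, M.vis (σ j) * M.appeal j i + M.z)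
    (c := fun i => M.weight i * M.quality i i * M.vis (σ i)) (v := fun i => M.vis (σ i))
    (fun i => M.appeal_pos i i) (fun i => ?_) (fun i => M.vis_nonneg _) hv
    (fun i => mul_nonneg (mul_nonneg (M.weight_nonneg i) (M.quality_nonneg i i)) (M.vis_nonneg _))
    (mul_pos (weight_pos i₀) hpos)
    (mul_le_one₀ (weight_le_one i₀) (M.quality_nonneg _ _) (M.quality_le_one _ _)) rfl ?_ hdom
    (fun n i => ?_) 0
  · exact add_pos_of_pos_of_nonneg (Finset.sum_pos' (fun j _ => hnn j i)
      ⟨i₀, Finset.mem_univ _, mul_pos hv (M.appeal_pos _ _)⟩) M.z_nonneg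
  · exact (Finset.single_le_sum (f := fun j => M.vis (σ j) * M.appeal j i₀)
      (fun j _ => hnn j i₀) (Finset.mem_univ i₀)).trans (le_add_of_nonneg_right M.z_nonneg)
  · rw [diagRate, tryProb, globalSignal_diagCounts]
    simp only [mul_add, Finset.sum_add_distrib]
    rw [mul_div_assoc', add_left_comm (∑ j, M.vis (σ j) * (n j : ℝ)), ← add_assoc]
    ring

end Diagonal

end MMNL

/-! ### The extremal model -/

theorem diagQuality_of_ne {K : ℕ} (w : Fin K → ℝ) (k₀ : Fin K) (ε : ℝ) {i k : Fin K}
    (h : i ≠ k) : diagQuality w k₀ ε i k = 0 := if_neg h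

theorem Fin.le_of_forall_ne_lt {K : ℕ} (σ : Equiv.Perm (Fin K)) {i : Fin K}
    (h : ∀ j, j ≠ i → σ i < σ j) (p : Fin K) : σ i ≤ p := by
  obtain ⟨j, rfl⟩ := σ.surjective p
  rcases eq_or_ne j i with rfl | hj
  · exact le_rfl
  · exact (h j hj).le

namespace MMNL

theorem exists_quality_eq_diagQuality {K : ℕ} {rate : Fin K → ℝ} {k₀ : Fin K}
    {appeal : Fin K → Fin K → ℝ} {vis : Fin K → ℝ} {z ε : ℝ} (hrate : ∀ k, 0 < rate k)
    (happeal : ∀ i k, 0 < appeal i k)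
    (hvis : ∀ j, 0 ≤ vis j) (hanti : Antitone vis) (hex : ∃ j, 0 < vis j) (hz : 0 ≤ z)
    (hε : 0 < ε)
    (hε' : ∀ k, k ≠ k₀ → ε < (⨅ j, classWeight rate j) / classWeight rate k) :
    ∃ M : MMNL K K, M.rate = rate ∧ M.appeal = appeal ∧ M.vis = vis ∧ M.z = z ∧
      M.quality = diagQuality (classWeight rate) k₀ ε := by
  have hw : ∀ k, 0 < classWeight rate k := fun k =>
    div_pos (hrate k) (Finset.sum_pos (fun l _ => hrate l) ⟨k, Finset.mem_univ k⟩)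
  have : Nonempty (Fin K) := ⟨k₀⟩
  have hle : ∀ k, (⨅ j, classWeight rate j) / classWeight rate k ≤ 1 := fun k =>
    (div_le_one (hw k)).2 (ciInf_le (Set.finite_range _).bddBelow k)
  have h0 : 0 ≤ ⨅ j, classWeight rate j := le_ciInf fun j => (hw j).le
  refine ⟨⟨rate, appeal, diagQuality (classWeight rate) k₀ ε, vis, z, k₀.pos, hrate, happeal,
    fun i k => ?_, fun i k => ?_, hvis, hanti, hex, hz⟩, rfl, rfl, rfl, rfl, rfl⟩
  all_goals
    rw [diagQuality]
    split_ifs with h1 h2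
  · exact div_nonneg h0 (hw k₀).le
  · exact (sub_pos.2 (hε' k h2)).le
  · exact le_rfl
  · exact hle k₀
  · linarith [hle k]
  · exact zero_le_one

/-- The limits of the purchase probabilities in the extremal model. -/
theorem extremal_limits {K : ℕ} {rate : Fin K → ℝ} {k₀ : Fin K} {ε : ℝ}
    (hmin : ∀ k, classWeight rate k₀ ≤ classWeight rate k) (hε : 0 < ε)
    (hε' : ∀ k, k ≠ k₀ → ε < (⨅ j, classWeight rate j) / classWeight rate k)
    {M : MMNL K K} (hMr : M.rate = rate) (hMq : M.quality = diagQuality (classWeight rate) k₀ ε)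
    {σ : Equiv.Perm (Fin K)} {τ : Fin K → Equiv.Perm (Fin K)}
    (hσ : M.IsAvgQualityRanking σ) (hτ : M.IsSegQualityRanking τ) :
    M.TieBreaking σ ∧ M.SegTieBreaking ∧
      Tendsto (fun t => M.probSQSSI τ t) atTop
        (𝓝 (K * classWeight rate k₀ - (1 - classWeight rate k₀) * ε)) ∧
      Tendsto (fun t => M.probAQGSI σ t) atTop (𝓝 (classWeight rate k₀)) ∧
      0 < classWeight rate k₀ := by
  subst hMr
  have hw : ∀ k, 0 < classWeight M.rate k := M.weight_pos
  have : Nonempty (Fin K) := ⟨k₀⟩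
  have hinf : ⨅ j, classWeight M.rate j = classWeight M.rate k₀ :=
    le_antisymm (ciInf_le (Set.finite_range _).bddBelow k₀) (le_ciInf hmin)
  rw [hinf] at hε'
  have hq : ∀ i k, i ≠ k → M.quality i k = 0 := fun i k h => by
    rw [hMq, diagQuality_of_ne _ _ _ h]
  have hq₀ : M.quality k₀ k₀ = 1 := by
    rw [hMq, diagQuality, if_pos rfl, if_pos rfl, hinf, div_self (hw k₀).ne']
  have hqk : ∀ k, k ≠ k₀ → M.quality k k = classWeight M.rate k₀ / classWeight M.rate k - ε := by
    intro k hk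
    rw [hMq, diagQuality, if_pos rfl, if_neg hk, hinf]
  have hpos : ∀ k, 0 < M.quality k k := by
    intro k
    rcases eq_or_ne k k₀ with rfl | hk
    · rw [hq₀]; exact one_pos
    · rw [hqk k hk]; exact sub_pos.2 (hε' k hk)
  have hwq : ∀ k, k ≠ k₀ →
      M.weight k * M.quality k k = classWeight M.rate k₀ - classWeight M.rate k * ε := by
    intro k hk
    rw [hqk k hk, mul_sub, weight, mul_div_cancel₀ _ (hw k).ne']
  have hwq₀ : M.weight k₀ * M.quality k₀ k₀ = classWeight M.rate k₀ := by
    rw [hq₀, mul_one, weight]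
  have havg : ∀ i, M.avgQuality i = M.weight i * M.quality i i := fun i =>
    Finset.sum_eq_single i (fun k _ hk => by rw [hq i k hk.symm, mul_zero]) (by simp)
  have hlt : ∀ i, i ≠ k₀ → M.avgQuality i < M.avgQuality k₀ := fun i hi => by
    rw [havg, havg, hwq i hi, hwq₀]
    linarith [mul_pos (hw i) hε]
  obtain ⟨p, hp⟩ := M.exists_vis_pos
  have hvtop : ∀ i, M.vis (σ i) ≤ M.vis (σ k₀) := fun i =>
    M.vis_antitone (Fin.le_of_forall_ne_lt σ (fun j hj => hσ _ _ (hlt j hj)) _)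
  have hv₀ : 0 < M.vis (σ k₀) := hp.trans_le (by simpa using hvtop (σ.symm p))
  have hseg : ∀ k j, j ≠ k → M.quality j k < M.quality k k := fun k j hj => by
    rw [hq j k hj]; exact hpos k
  have hvτ : ∀ k, 0 < M.vis (τ k k) := fun k => hp.trans_le
    (M.vis_antitone (Fin.le_of_forall_ne_lt (τ k) (fun j hj => hτ k _ _ (hseg k j hj)) p))
  have htb : ∀ i, i ≠ k₀ →
      M.avgQuality i * M.vis (σ i) < M.avgQuality k₀ * M.vis (σ k₀) := fun i hi =>
    (mul_le_mul_of_nonneg_left (hvtop i) (by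
      rw [havg]; exact mul_nonneg (M.weight_nonneg i) (M.quality_nonneg i i))).trans_lt
      (mul_lt_mul_of_pos_right (hlt i hi) hv₀)
  refine ⟨⟨k₀, htb⟩, fun k => ⟨k, hseg k⟩, ?_, ?_, hw k₀⟩
  · have hsum : ∑ k, M.weight k * M.quality k k =
        K * classWeight M.rate k₀ - (1 - classWeight M.rate k₀) * ε := by
      -- The term `w k * ε` is lost for every class except `k₀`, for which the `if` restores it.
      have h1 : ∑ k, M.weight k * M.quality k k =
          ∑ k, (classWeight M.rate k₀ - M.weight k * ε + if k = k₀ then M.weight k * ε else 0) := by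
        refine Finset.sum_congr rfl fun k _ => ?_
        split_ifs with hk
        · rw [hk, hwq₀]; ring
        · rw [hwq k hk, weight]; ring
      rw [h1, Finset.sum_add_distrib, Finset.sum_sub_distrib, ← Finset.sum_mul, M.sum_weight]
      simp [weight]
      ring
    rw [← hsum]
    exact tendsto_probSQSSI_of_diag hq hpos hvτ
  · rw [← hwq₀]
    refine tendsto_probAQGSI_of_diag hq hv₀ (hpos k₀) fun i hi => ?_
    rw [← havg, ← havg]
    exact htb i hi

end MMNL

/-! ### Existence of rankings and the conclusion -/

theorem exists_perm_sorting {K : ℕ} (f : Fin K → ℝ) :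
    ∃ σ : Equiv.Perm (Fin K), ∀ i j, f j < f i → σ i < σ j := by
  -- `Tuple.sort` sends positions to items, whereas a ranking sends items to positions; hence the
  -- inverse. The sign makes the order decreasing.
  refine ⟨(Tuple.sort fun i => -f i).symm, fun i j h => ?_⟩
  by_contra hle
  have := Tuple.monotone_sort (fun i => -f i) (not_lt.1 hle)
  simp only [Function.comp_apply, Equiv.apply_symm_apply] at this
  linarith

theorem mainTheorem7 (K : ℕ) (hK : 0 < K) :
    (∀ (rate : Fin K → ℝ) (k₀ : Fin K) (appeal : Fin K → Fin K → ℝ) (vis : Fin K → ℝ) (z : ℝ),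
      (∀ k, 0 < rate k) → (∀ k, classWeight rate k₀ ≤ classWeight rate k) →
      (∀ i k, 0 < appeal i k) →
      (∀ j, 0 ≤ vis j) → Antitone vis → (∃ j, 0 < vis j) → 0 ≤ z →
      ∃ PS PA : ℝ → ℝ,
        (∀ ε : ℝ, 0 < ε →
          (∀ k, k ≠ k₀ → ε < (⨅ j, classWeight rate j) / classWeight rate k) →
          ∃ M : MMNL K K,
            M.rate = rate ∧ M.appeal = appeal ∧ M.vis = vis ∧ M.z = z ∧
            M.quality = diagQuality (classWeight rate) k₀ ε ∧
            ∀ (σ : Equiv.Perm (Fin K)) (τ : Fin K → Equiv.Perm (Fin K)),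
              M.IsAvgQualityRanking σ → M.IsSegQualityRanking τ →
              M.TieBreaking σ ∧ M.SegTieBreaking ∧
              Tendsto (fun t => M.probSQSSI τ t) atTop (𝓝 (PS ε)) ∧
              Tendsto (fun t => M.probAQGSI σ t) atTop (𝓝 (PA ε)) ∧
              0 < PA ε ∧
              Tendsto (fun t => M.probSQSSI τ t / M.probAQGSI σ t) atTop
                (𝓝 (PS ε / PA ε))) ∧
        Tendsto (fun ε => PS ε / PA ε) (𝓝[>] 0) (𝓝 (K : ℝ))) ∧
    (∀ C : ℝ, C < K →
      ∃ (M : MMNL K K) (σ : Equiv.Perm (Fin K)) (τ : Fin K → Equiv.Perm (Fin K)) (L : ℝ),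
        M.IsAvgQualityRanking σ ∧ M.IsSegQualityRanking τ ∧
        M.TieBreaking σ ∧ M.SegTieBreaking ∧
        Tendsto (fun t => M.probSQSSI τ t / M.probAQGSI σ t) atTop (𝓝 L) ∧
        C < L ∧ L ≤ K) := by
  have hlim : ∀ m : ℝ, 0 < m →
      Tendsto (fun ε : ℝ => (K * m - (1 - m) * ε) / m) (𝓝[>] 0) (𝓝 (K : ℝ)) := by
    intro m hm
    have h : Tendsto (fun ε : ℝ => (K * m - (1 - m) * ε) / m) (𝓝 0)
        (𝓝 ((K * m - (1 - m) * 0) / m)) := Continuous.tendsto (by fun_prop) 0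
    rw [mul_zero, sub_zero, mul_div_cancel_right₀ _ hm.ne'] at h
    exact h.mono_left nhdsWithin_le_nhds
  refine ⟨?_, fun C hC => ?_⟩
  · intro rate k₀ appeal vis z hrate hmin happeal hvis hanti hex hz
    have hw₀ : 0 < classWeight rate k₀ :=
      div_pos (hrate k₀) (Finset.sum_pos (fun l _ => hrate l) ⟨k₀, Finset.mem_univ k₀⟩)
    refine ⟨fun ε => K * classWeight rate k₀ - (1 - classWeight rate k₀) * ε,
      fun _ => classWeight rate k₀, fun ε hε hε' => ?_, hlim _ hw₀⟩
    obtain ⟨M, hMr, hMa, hMv, hMz, hMq⟩ := MMNL.exists_quality_eq_diagQuality hrate happeal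
      hvis hanti hex hz hε hε'
    refine ⟨M, hMr, hMa, hMv, hMz, hMq, fun σ τ hσ hτ => ?_⟩
    obtain ⟨h1, h2, h3, h4, h5⟩ := MMNL.extremal_limits hmin hε hε' hMr hMq hσ hτ
    exact ⟨h1, h2, h3, h4, h5, h3.div h4 h5.ne'⟩
  · let k₀ : Fin K := ⟨0, hK⟩
    have hKpos : (0 : ℝ) < K := Nat.cast_pos.2 hK
    have hweight : ∀ k : Fin K, classWeight (fun _ => (1 : ℝ)) k = 1 / K := fun k => by
      simp [classWeight]
    have : Nonempty (Fin K) := ⟨k₀⟩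
    have hm1 : (1 : ℝ) / K ≤ 1 := (div_le_one hKpos).2 (by exact_mod_cast hK)
    -- With equal rates every quotient `min w / w k` is `1`, so `ε < 1` is the whole validity
    -- condition.
    obtain ⟨ε, hCε, hε1, hε⟩ := (((hlim (1 / K) (by positivity)).eventually (lt_mem_nhds hC)).and
      ((Filter.Eventually.filter_mono nhdsWithin_le_nhds (gt_mem_nhds one_pos)).and
        self_mem_nhdsWithin)).exists
    have hmin : ∀ k : Fin K,
        classWeight (fun _ => (1 : ℝ)) k₀ ≤ classWeight (fun _ => (1 : ℝ)) k := fun k => by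
      rw [hweight, hweight]
    have hε' : ∀ k : Fin K, k ≠ k₀ → ε < (⨅ j : Fin K, classWeight (fun _ => (1 : ℝ)) j) /
        classWeight (fun _ => (1 : ℝ)) k := fun k _ => by
      simp only [hweight, ciInf_const]
      rwa [div_self (by positivity)]
    obtain ⟨M, hMr, -, -, -, hMq⟩ := MMNL.exists_quality_eq_diagQuality
      (rate := fun _ => 1) (appeal := fun _ _ => 1) (vis := fun _ => 1) (z := 0)
      (fun _ => one_pos) (fun _ _ => one_pos) (fun _ => zero_le_one) antitone_const
      ⟨k₀, one_pos⟩ le_rfl hε hε'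
    obtain ⟨σ, hσ⟩ := exists_perm_sorting M.avgQuality
    choose τ hτ using fun k => exists_perm_sorting fun i => M.quality i k
    obtain ⟨h1, h2, h3, h4, h5⟩ := MMNL.extremal_limits hmin hε hε' hMr hMq hσ hτ
    refine ⟨M, σ, τ, _, hσ, hτ, h1, h2, h3.div h4 h5.ne', ?_, ?_⟩
    · rwa [hweight]
    · rw [hweight, div_le_iff₀ (by positivity)]
      linarith [mul_nonneg (sub_nonneg.2 hm1) (le_of_lt hε)]
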